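/- A weak Heyting Brouwer algebra (WHB-algebra) is an algebra $\mathbf{A}=(A,\wedge,\vee,\to,\leftarrow,0,1)$ such that $(A,\wedge,\vee,0,1)$ is a bounded distributive lattice and for all $a,b,c\in A$: $a\to a=1$, $a\to(b\wedge c)=(a\to b)\wedge(a\to c)$, $(a\vee b)\to c=(a\to c)\wedge(b\to c)$, $(a\to b)\wedge(b\to c)\le a\to c$; $a\leftarrow a=0$, $(a\vee b)\leftarrow c=(a\leftarrow c)\vee(b\leftarrow c)$, $a\leftarrow(b\wedge c)=(a\leftarrow b)\vee(a\leftarrow c)$, $a\leftarrow c\le(a\leftarrow b)\vee(b\leftarrow c)$; $a\wedge((a\to b)\leftarrow 0)\le b$ and $a\le b\vee(1\to(a\leftarrow b))$. A tense algebra is a Boolean algebra $\mathbf{B}$ with unary operators $G,H$ such that, writing $Px=\neg H\neg x$ and $Fx=\neg G\neg x$, one has $Px\le y\iff x\le Gy$ and $Fx\le y\iff x\le Hy$ for all $x,y\in B$. A tense filter of $\mathbf{B}$ is a (possibly improper) lattice filter of $\mathbf{B}$ closed under $G$ and $H$. For a WHB-algebra $\mathbf{A}$, let $X(\mathbf{A})$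 be the set of its (proper) prime filters and $\sigma(a)=\{P\in X(\mathbf{A}) : a\in P\}$ for $a\in A$. For $P,Q\in X(\mathbf{A})$, let $(P,Q)\in R_{\mathbf{A}}$ iff for all $a,b\in A$, $a\to b\in P$ and $a\in Q$ imply $b\in Q$; and let $(P,Q)\in S_{\mathbf{A}}$ iff for all $a,b\in A$, $a\in Q$ and $b\notin Q$ imply $a\leftarrow b\in P$. The free tense extension $T(\mathbf{A})$ is the tense algebra whose elements are the finite unions $\bigcup_{i}(\sigma(a_i)\setminus\sigma(b_i))$ with $a_i,b_i\in A$ (the free Boolean extension of the lattice reduct of $\mathbf{A}$), with the set-theoretic Boolean operations and $G(U)=\{P : R_{\mathbf{A}}(P)\subseteq U\}$, $H(U)=\{P : S_{\mathbf{A}}(P)\subseteq U\}$. Theorem. For every WHB-algebra $\mathbf{A}$, the lattice of congruences of the WHB-algebra $\mathbf{A}$ is isomorphic to the lattice of congruences of the tense algebra $T(\mathbf{A})$. Consequently, it is also isomorphic to the lattice of tense filters of $T(\mathbf{A})$ (all three lattices being ordered by inclusion). -/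

import Mathlib

open Order

/-! ## Weak Heyting Brouwer algebras -/

/-- Weak Heyting algebras: bounded distributive lattices with a strict implication
`wimp a b`, written `a → b`. -/
class WeakHeytingAlgebra (A : Type*) extends DistribLattice A, BoundedOrder A where
  wimp : A → A → A
  wimp_self : ∀ a : A, wimp a a = ⊤
  wimp_inf : ∀ a b c : A, wimp a (b ⊓ c) = wimp a b ⊓ wimp a c
  sup_wimp : ∀ a b c : A, wimp (a ⊔ b) c = wimp a c ⊓ wimp b c
  wimp_trans : ∀ a b c : A, wimp a b ⊓ wimp b c ≤ wimp a c

/-- Weak difference algebras: bounded distributive lattices with a weak difference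
`wdiff a b`, written `a ← b`. -/
class WeakDifferenceAlgebra (A : Type*) extends DistribLattice A, BoundedOrder A where
  wdiff : A → A → A
  wdiff_self : ∀ a : A, wdiff a a = ⊥
  sup_wdiff : ∀ a b c : A, wdiff (a ⊔ b) c = wdiff a c ⊔ wdiff b c
  wdiff_inf : ∀ a b c : A, wdiff a (b ⊓ c) = wdiff a b ⊔ wdiff a c
  wdiff_trans : ∀ a b c : A, wdiff a c ≤ wdiff a b ⊔ wdiff b c

/-- Double weak Heyting algebras (both structures on the same bounded distributive lattice). -/
class DoubleWeakHeytingAlgebra (A : Type*) extends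
  WeakHeytingAlgebra A, WeakDifferenceAlgebra A

/-- Weak Heyting Brouwer algebras (WHB-algebras). -/
class WHBAlgebra (A : Type*) extends DoubleWeakHeytingAlgebra A where
  inf_wdiff_wimp_le : ∀ a b : A, a ⊓ wdiff (wimp a b) ⊥ ≤ b
  le_sup_wimp_wdiff : ∀ a b : A, a ≤ b ⊔ wimp ⊤ (wdiff a b)

/-! ## Tense algebras -/

/-- Tense (Boolean) algebras: a Boolean algebra with operators `G`, `H` such that
`P ⊣ G` and `F ⊣ H`, where `P x = ¬ H (¬ x)` and `F x = ¬ G (¬ x)`. -/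
class TenseAlgebra (B : Type*) extends BooleanAlgebra B where
  G : B → B
  H : B → B
  gc_P_G : GaloisConnection (fun x : B => (H xᶜ)ᶜ) G
  gc_F_H : GaloisConnection (fun x : B => (G xᶜ)ᶜ) H

/-! ## Congruence lattices and tense filters -/

/-- Congruences of a WHB-algebra (in the signature `∧, ∨, →, ←, 0, 1`). -/
structure WHBCon (A : Type*) [WHBAlgebra A] extends LatticeCon A where
  wimp : ∀ {w x y z : A}, r w x → r y z →
    r (WeakHeytingAlgebra.wimp w y) (WeakHeytingAlgebra.wimp x z)
  wdiff : ∀ {w x y z : A}, r w x → r y z →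
    r (WeakDifferenceAlgebra.wdiff w y) (WeakDifferenceAlgebra.wdiff x z)

namespace WHBCon

variable {A : Type*} [WHBAlgebra A]

theorem r_injective : Function.Injective (fun c : WHBCon A => c.r) := by
  rintro ⟨⟨⟨r, _⟩, _, _⟩, _, _⟩ ⟨⟨⟨s, _⟩, _, _⟩, _, _⟩ h
  cases h
  rfl

/-- Congruences are ordered by inclusion. -/
instance : PartialOrder (WHBCon A) := PartialOrder.lift (fun c => c.r) r_injective

instance : InfSet (WHBCon A) where
  sInf S :=
    { r := fun x y => ∀ c ∈ S, c.r x y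
      iseqv := ⟨fun x c _ => c.refl x, fun h c hc => c.symm (h c hc),
        fun h h' c hc => c.trans (h c hc) (h' c hc)⟩
      inf := fun h h' c hc => c.inf (h c hc) (h' c hc)
      sup := fun h h' c hc => c.sup (h c hc) (h' c hc)
      wimp := fun h h' c hc => c.wimp (h c hc) (h' c hc)
      wdiff := fun h h' c hc => c.wdiff (h c hc) (h' c hc) }

instance : CompleteLattice (WHBCon A) :=
  completeLatticeOfInf (WHBCon A) fun _ =>
    ⟨fun c hc _ _ h => h c hc, fun _ hd _ _ h _ hc => hd hc _ _ h⟩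

end WHBCon

/-- Congruences of a tense algebra (in the signature `∨, ∧, ¬, G, H, 0, 1`). -/
structure TenseCon (B : Type*) [TenseAlgebra B] extends LatticeCon B where
  compl : ∀ {x y : B}, r x y → r xᶜ yᶜ
  G : ∀ {x y : B}, r x y → r (TenseAlgebra.G x) (TenseAlgebra.G y)
  H : ∀ {x y : B}, r x y → r (TenseAlgebra.H x) (TenseAlgebra.H y)

namespace TenseCon

variable {B : Type*} [TenseAlgebra B]

theorem r_injective : Function.Injective (fun c : TenseCon B => c.r) := by
  rintro ⟨⟨⟨r, _⟩, _, _⟩, _, _, _⟩ ⟨⟨⟨s, _⟩, _, _⟩, _, _, _⟩ h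
  cases h
  rfl

/-- Congruences are ordered by inclusion. -/
instance : PartialOrder (TenseCon B) := PartialOrder.lift (fun c => c.r) r_injective

instance : InfSet (TenseCon B) where
  sInf S :=
    { r := fun x y => ∀ c ∈ S, c.r x y
      iseqv := ⟨fun x c _ => c.refl x, fun h c hc => c.symm (h c hc),
        fun h h' c hc => c.trans (h c hc) (h' c hc)⟩
      inf := fun h h' c hc => c.inf (h c hc) (h' c hc)
      sup := fun h h' c hc => c.sup (h c hc) (h' c hc)
      compl := fun h c hc => c.compl (h c hc)
      G := fun h c hc => c.G (h c hc)
      H := fun h c hc => c.H (h c hc) }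

instance : CompleteLattice (TenseCon B) :=
  completeLatticeOfInf (TenseCon B) fun _ =>
    ⟨fun c hc _ _ h => h c hc, fun _ hd _ _ h _ hc => hd hc _ _ h⟩

end TenseCon

/-- Tense filters: lattice filters (possibly improper) closed under `G` and `H`. -/
structure TenseFilter (B : Type*) [TenseAlgebra B] extends PFilter B where
  G_mem : ∀ {x : B}, x ∈ toPFilter → TenseAlgebra.G x ∈ toPFilter
  H_mem : ∀ {x : B}, x ∈ toPFilter → TenseAlgebra.H x ∈ toPFilter

namespace TenseFilter

variable {B : Type*} [TenseAlgebra B]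

theorem toPFilter_injective :
    Function.Injective (TenseFilter.toPFilter : TenseFilter B → PFilter B) := by
  rintro ⟨F, _, _⟩ ⟨F', _, _⟩ h
  cases h
  rfl

/-- Tense filters are ordered by inclusion. -/
instance : PartialOrder (TenseFilter B) :=
  PartialOrder.lift TenseFilter.toPFilter toPFilter_injective

theorem isPFilter_iInter (S : Set (TenseFilter B)) :
    IsPFilter {x : B | ∀ F ∈ S, x ∈ F.toPFilter} :=
  IsPFilter.of_def ⟨⊤, fun _ _ => PFilter.top_mem⟩
    (fun x hx y hy =>
      ⟨x ⊓ y, fun F hF => PFilter.inf_mem (hx F hF) (hy F hF), inf_le_left, inf_le_right⟩)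
    (fun hxy hx F hF => PFilter.mem_of_le hxy (hx F hF))

instance : InfSet (TenseFilter B) where
  sInf S :=
    { toPFilter := (isPFilter_iInter S).toPFilter
      G_mem := fun hx F hF => F.G_mem (hx F hF)
      H_mem := fun hx F hF => F.H_mem (hx F hF) }

instance : CompleteLattice (TenseFilter B) :=
  completeLatticeOfInf (TenseFilter B) fun _ =>
    ⟨fun F hF _ h => h F hF, fun _ hE _ h _ hF => hE hF h⟩

end TenseFilter

/-! ## Prime filters, the Stone map and the free Boolean extension -/

/-- The set `X(L)` of prime filters of `L`; prime filters are proper. -/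
abbrev PrimeFilter (L : Type*) [DistribLattice L] [BoundedOrder L] : Type _ :=
  {P : PFilter L // P.IsPrime}

section FreeBoolean

variable {L : Type*} [DistribLattice L] [BoundedOrder L]

theorem PrimeFilter.bot_notMem (P : PrimeFilter L) : (⊥ : L) ∉ P.1 := by
  obtain ⟨x, hx⟩ := P.2.compl_ideal.Nonempty
  exact P.2.compl_ideal.IsLowerSet bot_le hx

theorem PrimeFilter.sup_mem_iff (P : PrimeFilter L) {a b : L} :
    a ⊔ b ∈ P.1 ↔ a ∈ P.1 ∨ b ∈ P.1 := by
  constructor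
  · intro h
    by_contra! hab
    obtain ⟨c, hc, hac, hbc⟩ := P.2.compl_ideal.Directed a hab.1 b hab.2
    exact hc (PFilter.mem_of_le (sup_le hac hbc) h)
  · rintro (h | h)
    · exact PFilter.mem_of_le le_sup_left h
    · exact PFilter.mem_of_le le_sup_right h

/-- A set with the usual elementary properties is a prime filter. -/
theorem PrimeFilter.exists_coe_eq (Q : Set L) (top : ⊤ ∈ Q) (bot : ⊥ ∉ Q)
    (up : ∀ x y, x ≤ y → x ∈ Q → y ∈ Q) (inf : ∀ x y, x ∈ Q → y ∈ Q → x ⊓ y ∈ Q)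
    (prime : ∀ x y, x ⊔ y ∈ Q → x ∈ Q ∨ y ∈ Q) :
    ∃ P : PrimeFilter L, ∀ x, x ∈ P.1 ↔ x ∈ Q := by
  have hF : IsPFilter Q := IsPFilter.of_def ⟨⊤, top⟩
    (fun x hx y hy => ⟨x ⊓ y, inf x y hx hy, inf_le_left, inf_le_right⟩)
    (fun {x y} hxy hx => up x y hxy hx)
  refine ⟨⟨hF.toPFilter, ⟨⟨?_, ⟨⊥, bot⟩, ?_⟩⟩⟩, fun x => Iff.rfl⟩
  · intro x y hyx hx hy
    exact hx (up y x hyx hy)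
  · intro x hx y hy
    exact ⟨x ⊔ y, fun h => (prime x y h).elim hx hy, le_sup_left, le_sup_right⟩

/-- The Stone map `a ↦ {P | a ∈ P}`. -/
def stoneMap (a : L) : Set (PrimeFilter L) := {P | a ∈ P.1}

variable (L) in
/-- The free Boolean extension of `L`: the Boolean algebra of all finite unions
`⋃ i, σ(aᵢ) \ σ(bᵢ)` of sets of prime filters. -/
def freeBooleanExtension : BooleanSubalgebra (Set (PrimeFilter L)) where
  carrier := {U | ∃ t : Finset (L × L), U = ⋃ p ∈ t, stoneMap p.1 \ stoneMap p.2}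
  supClosed' := by
    classical
    rintro _ ⟨s, rfl⟩ _ ⟨t, rfl⟩
    exact ⟨s ∪ t, (Finset.set_biUnion_union s t _).symm⟩
  infClosed' := by
    classical
    rintro _ ⟨s, rfl⟩ _ ⟨t, rfl⟩
    refine ⟨(s ×ˢ t).image (fun q => (q.1.1 ⊓ q.2.1, q.1.2 ⊔ q.2.2)), ?_⟩
    ext P
    simp only [Set.inf_eq_inter, Set.mem_inter_iff, Set.mem_iUnion, Finset.mem_image,
      Finset.mem_product, stoneMap, Set.mem_sdiff, Set.mem_ofPred_eq, exists_prop]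
    constructor
    · rintro ⟨⟨p, hp, hp1, hp2⟩, q, hq, hq1, hq2⟩
      exact ⟨_, ⟨(p, q), ⟨hp, hq⟩, rfl⟩, PFilter.inf_mem hp1 hq1,
        fun h => (P.sup_mem_iff.1 h).elim hp2 hq2⟩
    · rintro ⟨_, ⟨⟨p, q⟩, ⟨hp, hq⟩, rfl⟩, h1, h2⟩
      exact ⟨⟨p, hp, (PFilter.inf_mem_iff.1 h1).1, fun h => h2 (P.sup_mem_iff.2 (.inl h))⟩,
        q, hq, (PFilter.inf_mem_iff.1 h1).2, fun h => h2 (P.sup_mem_iff.2 (.inr h))⟩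
  bot_mem' := ⟨∅, by simp⟩
  compl_mem' := by
    classical
    rintro _ ⟨t, rfl⟩
    induction t using Finset.induction_on with
    | empty =>
      refine ⟨{(⊤, ⊥)}, ?_⟩
      ext P
      simpa [stoneMap] using P.bot_notMem
    | insert p t _ ih =>
      obtain ⟨u, hu⟩ := ih
      refine ⟨(u.image fun q => (q.1, q.2 ⊔ p.1)) ∪ (u.image fun q => (q.1 ⊓ p.2, q.2)), ?_⟩
      rw [Finset.set_biUnion_insert, Set.compl_union, hu]
      ext P
      simp only [Set.mem_inter_iff, Set.mem_iUnion, Finset.mem_image, Finset.mem_union,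
        stoneMap, Set.mem_sdiff, Set.mem_ofPred_eq, exists_prop, Set.mem_compl_iff]
      constructor
      · rintro ⟨h, q, hq, hq1, hq2⟩
        by_cases hp : p.1 ∈ P.1
        · have hp2 : p.2 ∈ P.1 := by
            by_contra h'
            exact h ⟨hp, h'⟩
          exact ⟨_, .inr ⟨q, hq, rfl⟩, PFilter.inf_mem hq1 hp2, hq2⟩
        · exact ⟨_, .inl ⟨q, hq, rfl⟩, hq1, fun h' => (P.sup_mem_iff.1 h').elim hq2 hp⟩
      · rintro ⟨_, ⟨q, hq, rfl⟩ | ⟨q, hq, rfl⟩, h1, h2⟩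
        · exact ⟨fun h => h2 (P.sup_mem_iff.2 (.inr h.1)), q, hq, h1,
            fun h => h2 (P.sup_mem_iff.2 (.inl h))⟩
        · exact ⟨fun h => h.2 (PFilter.inf_mem_iff.1 h1).2, q, hq,
            (PFilter.inf_mem_iff.1 h1).1, h2⟩

theorem mem_freeBooleanExtension {U : Set (PrimeFilter L)} :
    U ∈ freeBooleanExtension L ↔
      ∃ t : Finset (L × L), U = ⋃ p ∈ t, stoneMap p.1 \ stoneMap p.2 := Iff.rfl

theorem stoneMap_mem (a : L) : stoneMap a ∈ freeBooleanExtension L := by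
  refine ⟨{(a, ⊥)}, ?_⟩
  ext P
  simpa [stoneMap] using fun _ => P.bot_notMem

theorem biInter_mem_freeBooleanExtension (t : Finset (L × L))
    (f : L × L → Set (PrimeFilter L)) (hf : ∀ p, f p ∈ freeBooleanExtension L) :
    (⋂ p ∈ t, f p) ∈ freeBooleanExtension L := by
  classical
  induction t using Finset.induction_on with
  | empty => simpa using (freeBooleanExtension L).top_mem
  | insert p t _ ih =>
    rw [Finset.set_biInter_insert]
    exact BooleanSubalgebra.inf_mem (hf p) ih

/-- The prime filter theorem for a strict implication, for sets. -/
theorem exists_prime_of_strict (m : L → L → L) (h1 : ∀ a, m a a = ⊤)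
    (h2 : ∀ a b c, m a (b ⊓ c) = m a b ⊓ m a c) (h3 : ∀ a b c, m (a ⊔ b) c = m a c ⊓ m b c)
    (h4 : ∀ a b c, m a b ⊓ m b c ≤ m a c) (P : Set L) (top : ⊤ ∈ P)
    (up : ∀ x y, x ≤ y → x ∈ P → y ∈ P) (inf : ∀ x y, x ∈ P → y ∈ P → x ⊓ y ∈ P)
    {a b : L} (hab : m a b ∉ P) :
    ∃ Q : Set L, ⊤ ∈ Q ∧ (∀ x y, x ≤ y → x ∈ Q → y ∈ Q) ∧
      (∀ x y, x ∈ Q → y ∈ Q → x ⊓ y ∈ Q) ∧ (∀ x y, x ⊔ y ∈ Q → x ∈ Q ∨ y ∈ Q) ∧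
      (∀ x y, m x y ∈ P → x ∈ Q → y ∈ Q) ∧ a ∈ Q ∧ b ∉ Q := by
  have mono : ∀ x y z, y ≤ z → m x y ≤ m x z := fun x y z h => by
    have := h2 x y z
    rw [inf_eq_left.2 h] at this
    exact inf_eq_left.1 this.symm
  have anti : ∀ x y z, x ≤ y → m y z ≤ m x z := fun x y z h => by
    have := h3 x y z
    rw [sup_eq_right.2 h] at this
    exact inf_eq_right.1 this.symm
  have of_le : ∀ x y, x ≤ y → m x y ∈ P := fun x y h =>
    up ⊤ _ (by rw [← h1 x]; exact mono _ _ _ h) top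
  have tr : ∀ x y z, m x y ∈ P → m y z ∈ P → m x z ∈ P := fun x y z h h' =>
    up _ _ (h4 x y z) (inf _ _ h h')
  let S : Set (Set L) := {Q | (∀ x y, x ≤ y → x ∈ Q → y ∈ Q) ∧
      (∀ x y, x ∈ Q → y ∈ Q → x ⊓ y ∈ Q) ∧
      (∀ x y, m x y ∈ P → x ∈ Q → y ∈ Q) ∧ a ∈ Q ∧ b ∉ Q}
  have hS0 : {x | m a x ∈ P} ∈ S :=
    ⟨fun x y h hx => up _ _ (mono a x y h) hx,
      fun x y hx hy => by
        change m a (x ⊓ y) ∈ P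
        rw [h2]
        exact inf _ _ hx hy,
      fun x y h hx => tr a x y hx h, of_le a a le_rfl, hab⟩
  obtain ⟨Q, -, hQ⟩ := zorn_subset_nonempty S (by
    intro c hc hchain ⟨q, hq⟩
    refine ⟨⋃₀ c, ⟨?_, ?_, ?_, ⟨q, hq, (hc hq).2.2.2.1⟩, ?_⟩,
      fun s hs => Set.subset_sUnion_of_mem hs⟩
    · rintro x y h ⟨s, hs, hx⟩
      exact ⟨s, hs, (hc hs).1 x y h hx⟩
    · rintro x y ⟨s, hs, hx⟩ ⟨t, ht, hy⟩
      rcases hchain.total hs ht with h | h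
      · exact ⟨t, ht, (hc ht).2.1 x y (h hx) hy⟩
      · exact ⟨s, hs, (hc hs).2.1 x y hx (h hy)⟩
    · rintro x y h ⟨s, hs, hx⟩
      exact ⟨s, hs, (hc hs).2.2.1 x y h hx⟩
    · rintro ⟨s, hs, hb⟩
      exact (hc hs).2.2.2.2 hb) _ hS0
  obtain ⟨hup, hinf, hR, ha, hb⟩ := hQ.prop
  have key : ∀ x, x ∉ Q → ∃ q ∈ Q, m (q ⊓ x) b ∈ P := by
    intro x hx
    by_contra hcon
    have hmem : {z | ∃ q ∈ Q, m (q ⊓ x) z ∈ P} ∈ S := by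
      refine ⟨?_, ?_, ?_, ⟨a, ha, of_le _ _ inf_le_left⟩, hcon⟩
      · rintro y z h ⟨q, hq, hy⟩
        exact ⟨q, hq, up _ _ (mono _ y z h) hy⟩
      · rintro y z ⟨q, hq, hy⟩ ⟨q', hq', hz⟩
        refine ⟨q ⊓ q', hinf _ _ hq hq', ?_⟩
        rw [h2]
        exact inf _ _ (up _ _ (anti _ _ _ (inf_le_inf_right x inf_le_left)) hy)
          (up _ _ (anti _ _ _ (inf_le_inf_right x inf_le_right)) hz)
      · rintro y z h ⟨q, hq, hy⟩
        exact ⟨q, hq, tr _ _ _ hy h⟩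
    exact hx (hQ.le_of_ge hmem (fun q hq => ⟨q, hq, of_le _ _ inf_le_left⟩)
      ⟨a, ha, of_le _ _ inf_le_right⟩)
  refine ⟨Q, hup a ⊤ le_top ha, hup, hinf, ?_, hR, ha, hb⟩
  intro x y hxy
  by_contra! hn
  obtain ⟨q, hq, hqx⟩ := key x hn.1
  obtain ⟨q', hq', hqy⟩ := key y hn.2
  refine hb (hR ((q ⊓ q') ⊓ (x ⊔ y)) b ?_ (hinf _ _ (hinf _ _ hq hq') hxy))
  rw [inf_sup_left, h3]
  exact inf _ _ (up _ _ (anti _ _ _ (inf_le_inf_right x inf_le_left)) hqx)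
    (up _ _ (anti _ _ _ (inf_le_inf_right y inf_le_right)) hqy)

end FreeBoolean

/-! ## The relations of the dual space -/

section Relations

variable {X : Type*}

/-- `U ⇒_R V = {x | R(x) ∩ U ⊆ V}`. -/
def relImp (R : X → X → Prop) (U V : Set X) : Set X := {x | {y | R x y} ∩ U ⊆ V}

/-- `U ⇐_S V = {x | S(x) ∩ (U \ V) ≠ ∅}`. -/
def relDiff (S : X → X → Prop) (U V : Set X) : Set X := {x | ({y | S x y} ∩ (U \ V)).Nonempty}

end Relations

section WHB

variable {A : Type*} [WHBAlgebra A]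

open WeakHeytingAlgebra WeakDifferenceAlgebra

/-- The relation `R_A` on prime filters. -/
def relR (P Q : PrimeFilter A) : Prop :=
  ∀ a b : A, wimp a b ∈ P.1 → a ∈ Q.1 → b ∈ Q.1

/-- The relation `S_A` on prime filters. -/
def relS (P Q : PrimeFilter A) : Prop :=
  ∀ a b : A, a ∈ Q.1 → b ∉ Q.1 → wdiff a b ∈ P.1

theorem relS_iff_relR {P Q : PrimeFilter A} : relS P Q ↔ relR Q P := by
  constructor
  · intro h a b hab ha
    exact PFilter.mem_of_le (WHBAlgebra.inf_wdiff_wimp_le a b)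
      (PFilter.inf_mem ha (h _ _ hab Q.bot_notMem))
  · intro h a b ha hb
    have := (Q.sup_mem_iff.1 (PFilter.mem_of_le (WHBAlgebra.le_sup_wimp_wdiff a b) ha))
    exact h _ _ (this.resolve_left hb) PFilter.top_mem

theorem stoneMap_wimp (a b : A) :
    stoneMap (wimp a b) = relImp relR (stoneMap a) (stoneMap b) := by
  ext P
  constructor
  · rintro h Q ⟨hPQ, ha⟩
    exact hPQ a b h ha
  · intro h
    by_contra hab
    obtain ⟨Q, h1, h2, h3, h4, h5, h6, h7⟩ := exists_prime_of_strict (L := A) wimp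
      wimp_self wimp_inf sup_wimp wimp_trans {x | x ∈ P.1} PFilter.top_mem
      (fun x y hxy hx => PFilter.mem_of_le hxy hx) (fun x y hx hy => PFilter.inf_mem hx hy) hab
    obtain ⟨Q', hQ'⟩ := PrimeFilter.exists_coe_eq Q h1 (fun h => h7 (h2 _ _ bot_le h)) h2 h3 h4
    refine h7 ((hQ' b).1 (h ⟨fun x y hxy hx => ?_, (hQ' a).2 h6⟩))
    exact (hQ' y).2 (h5 x y hxy ((hQ' x).1 hx))

theorem stoneMap_wdiff (a b : A) :
    stoneMap (wdiff a b) = relDiff relS (stoneMap a) (stoneMap b) := by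
  ext P
  constructor
  · intro hab
    obtain ⟨Q, h1, h2, h3, h4, h5, h6, h7⟩ := exists_prime_of_strict (L := Aᵒᵈ)
      (fun x y => OrderDual.toDual (wdiff (OrderDual.ofDual y) (OrderDual.ofDual x)))
      (fun x => wdiff_self (A := A) x) (fun x y z => sup_wdiff (A := A) y z x)
      (fun x y z => wdiff_inf (A := A) z x y)
      (fun x y z => (wdiff_trans (A := A) z y x).trans_eq (sup_comm _ _))
      {x | OrderDual.ofDual x ∉ P.1} P.bot_notMem
      (fun x y hxy hx hy => hx (PFilter.mem_of_le hxy hy))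
      (fun x y hx hy h => (P.sup_mem_iff.1 h).elim hx hy)
      (a := OrderDual.toDual b) (b := OrderDual.toDual a) (fun h => h hab)
    obtain ⟨Q', hQ'⟩ := PrimeFilter.exists_coe_eq (L := A) {x | OrderDual.toDual x ∉ Q}
      (fun h => h7 (h2 _ _ (le_top (a := a)) h)) (fun h => h h1)
      (fun x y hxy hx hy => hx (h2 _ _ hxy hy))
      (fun x y hx hy h => (h4 _ _ h).elim hx hy)
      (fun x y h => by
        by_contra! hn
        exact h (h3 _ _ (not_not.1 hn.1) (not_not.1 hn.2)))
    refine ⟨Q', fun x y hx hy => ?_, (hQ' a).2 h7, fun h => (hQ' b).1 h h6⟩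
    by_contra hxy
    have hy' : OrderDual.toDual y ∈ Q := by
      by_contra h
      exact hy ((hQ' y).2 h)
    exact (hQ' x).1 hx (h5 _ _ hxy hy')
  · rintro ⟨Q, hPQ, ha, hb⟩
    exact hPQ a b ha hb

/-! ## The free tense extension -/

/-- `G_A(U) = X(A) ⇒_R U`. -/
def tenseG (U : Set (PrimeFilter A)) : Set (PrimeFilter A) := relImp relR Set.univ U

/-- `H_A(U) = X(A) \ ((X(A) \ U) ⇐_S ∅)`. -/
def tenseH (U : Set (PrimeFilter A)) : Set (PrimeFilter A) := (relDiff relS Uᶜ ∅)ᶜ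

theorem mem_tenseG {U : Set (PrimeFilter A)} {P : PrimeFilter A} :
    P ∈ tenseG U ↔ ∀ Q, relR P Q → Q ∈ U :=
  ⟨fun h _ hQ => h ⟨hQ, trivial⟩, fun h _ hQ => h _ hQ.1⟩

theorem mem_tenseH {U : Set (PrimeFilter A)} {P : PrimeFilter A} :
    P ∈ tenseH U ↔ ∀ Q, relS P Q → Q ∈ U := by
  constructor
  · intro h Q hQ
    by_contra hU
    exact h ⟨Q, hQ, hU, id⟩
  · rintro h ⟨Q, hQ, hU, -⟩
    exact hU (h Q hQ)

theorem tenseG_mem {U : Set (PrimeFilter A)} (hU : U ∈ freeBooleanExtension A) :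
    tenseG U ∈ freeBooleanExtension A := by
  obtain ⟨t, ht⟩ := mem_freeBooleanExtension.1 (BooleanSubalgebra.compl_mem hU)
  have : tenseG U = ⋂ p ∈ t, stoneMap (wimp p.1 p.2) := by
    ext P
    simp only [Set.mem_iInter, stoneMap_wimp, mem_tenseG]
    constructor
    · rintro h p hp Q ⟨hPQ, hQ⟩
      by_contra hn
      have : Q ∈ Uᶜ := by
        rw [ht]
        exact Set.mem_biUnion hp ⟨hQ, hn⟩
      exact this (h Q hPQ)
    · intro h Q hPQ
      by_contra hn
      have hn : Q ∈ Uᶜ := hn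
      rw [ht] at hn
      obtain ⟨p, hp, h1, h2⟩ := Set.mem_iUnion₂.1 hn
      exact h2 (h p hp ⟨hPQ, h1⟩)
  rw [this]
  exact biInter_mem_freeBooleanExtension t _ fun p => stoneMap_mem _

theorem tenseH_mem {U : Set (PrimeFilter A)} (hU : U ∈ freeBooleanExtension A) :
    tenseH U ∈ freeBooleanExtension A := by
  obtain ⟨t, ht⟩ := mem_freeBooleanExtension.1 (BooleanSubalgebra.compl_mem hU)
  have : tenseH U = ⋂ p ∈ t, (stoneMap (wdiff p.1 p.2))ᶜ := by
    ext P
    simp only [Set.mem_iInter, stoneMap_wdiff, mem_tenseH]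
    constructor
    · rintro h p hp ⟨Q, hPQ, hQ⟩
      have : Q ∈ Uᶜ := by
        rw [ht]
        exact Set.mem_biUnion hp hQ
      exact this (h Q hPQ)
    · intro h Q hPQ
      by_contra hn
      have hn : Q ∈ Uᶜ := hn
      rw [ht] at hn
      obtain ⟨p, hp, h1⟩ := Set.mem_iUnion₂.1 hn
      exact h p hp ⟨Q, hPQ, h1⟩
  rw [this]
  exact biInter_mem_freeBooleanExtension t _ fun p =>
    BooleanSubalgebra.compl_mem (stoneMap_mem _)

variable (A) in
/-- The carrier of the free tense extension `T(A)` is the free Boolean extension of the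
lattice reduct of `A`. -/
abbrev FreeTenseExtension : Type _ := freeBooleanExtension A

/-- The free tense extension `T(A)`: its Boolean operations are the set operations and its
tense operators are `G_A` and `H_A`. -/
instance FreeTenseExtension.instTenseAlgebra : TenseAlgebra (FreeTenseExtension A) where
  G U := ⟨tenseG U.1, tenseG_mem U.2⟩
  H U := ⟨tenseH U.1, tenseH_mem U.2⟩
  gc_P_G U V := by
    change (tenseH U.1ᶜ)ᶜ ⊆ V.1 ↔ U.1 ⊆ tenseG V.1
    constructor
    · intro h P hP
      refine mem_tenseG.2 fun Q hPQ => h fun hQ => ?_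
      exact mem_tenseH.1 hQ P (relS_iff_relR.2 hPQ) hP
    · intro h P hP
      by_contra hV
      refine hP (mem_tenseH.2 fun Q hPQ hQ => hV ?_)
      exact mem_tenseG.1 (h hQ) P (relS_iff_relR.1 hPQ)
  gc_F_H U V := by
    change (tenseG U.1ᶜ)ᶜ ⊆ V.1 ↔ U.1 ⊆ tenseH V.1
    constructor
    · intro h P hP
      refine mem_tenseH.2 fun Q hPQ => h fun hQ => ?_
      exact mem_tenseG.1 hQ P (relS_iff_relR.1 hPQ) hP
    · intro h P hP
      by_contra hV
      refine hP (mem_tenseG.2 fun Q hPQ hQ => hV ?_)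
      exact mem_tenseH.1 (h hQ) P (relS_iff_relR.2 hPQ)

end WHB

/-! ## Quotients of distributive lattices and separation by prime filters -/

/-! The isomorphism is restriction along the Stone embedding `a ↦ σ(a)`. Restriction makes sense
because `→` and `←` are terms of `T(A)`: `σ(a → b) = G(σ(a) ⇨ σ(b))` and `σ(a ← b) = (H(σ(a) ⇨
σ(b)))ᶜ` (`embed_wimp`, `embed_wdiff`).

Restriction is injective: a tense congruence is determined by its class of `⊤`, which is a filter.
Each element of `T(A)` is a finite meet of sets `σ(a) ⇨ σ(b)` (`exists_eq_inf_himp`), and such a set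
is congruent to `⊤` exactly when `σ(a ⊓ b)` is congruent to `σ(a)`, a condition on `A` alone.

Restriction is surjective: for a congruence `θ` of `A`, identify two sets when they contain the same
saturated prime filters, that is, those that are unions of `θ`-classes. This respects `G` and `H`
because the saturated prime filters are closed under `R`- and `S`-successors (`isSaturated_of_relR`,
`isSaturated_of_relS`). It restricts to `θ` because the prime ideal theorem in the quotient by `θ`
separates non-congruent elements (`r_of_forall_isSaturated`).

Tense filters enter by the usual correspondence between a congruence and its class of `⊤`. -/

namespace LatticeCon

/-- The quotient of a lattice by a lattice congruence. -/
def Quot {L : Type*} [Lattice L] (c : LatticeCon L) : Type _ := Quotient c.toSetoid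

/-- The canonical projection to the quotient by a lattice congruence. -/
def proj {L : Type*} [Lattice L] (c : LatticeCon L) (x : L) : c.Quot := Quotient.mk c.toSetoid x

instance {L : Type*} [Lattice L] (c : LatticeCon L) : Max c.Quot :=
  ⟨Quotient.map₂ (· ⊔ ·) fun _ _ h _ _ h' => c.sup h h'⟩

instance {L : Type*} [Lattice L] (c : LatticeCon L) : Min c.Quot :=
  ⟨Quotient.map₂ (· ⊓ ·) fun _ _ h _ _ h' => c.inf h h'⟩

instance {L : Type*} [Lattice L] (c : LatticeCon L) : Lattice c.Quot :=
  Lattice.mk'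
    (by rintro ⟨x⟩ ⟨y⟩; exact congrArg c.proj (sup_comm x y))
    (by rintro ⟨x⟩ ⟨y⟩ ⟨z⟩; exact congrArg c.proj (sup_assoc x y z))
    (by rintro ⟨x⟩ ⟨y⟩; exact congrArg c.proj (inf_comm x y))
    (by rintro ⟨x⟩ ⟨y⟩ ⟨z⟩; exact congrArg c.proj (inf_assoc x y z))
    (by rintro ⟨x⟩ ⟨y⟩; exact congrArg c.proj sup_inf_self)
    (by rintro ⟨x⟩ ⟨y⟩; exact congrArg c.proj inf_sup_self)

instance {L : Type*} [DistribLattice L] (c : LatticeCon L) : DistribLattice c.Quot :=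
  DistribLattice.ofInfSupLe (by
    rintro ⟨x⟩ ⟨y⟩ ⟨z⟩
    exact le_of_eq (congrArg c.proj (inf_sup_left x y z)))

variable {L : Type*} [DistribLattice L] [BoundedOrder L]

/-- A prime filter is saturated for a congruence if it is a union of congruence classes. -/
def IsSaturated (c : LatticeCon L) (P : PrimeFilter L) : Prop :=
  ∀ a b, c.r a b → a ∈ P.1 → b ∈ P.1

/-- Elements that are not congruent are separated by a saturated prime filter. -/
theorem r_of_forall_isSaturated (c : LatticeCon L) {a b : L}
    (h : ∀ P, c.IsSaturated P → (a ∈ P.1 ↔ b ∈ P.1)) : c.r a b := by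
  have key : ∀ x y : L, (∀ P, c.IsSaturated P → x ∈ P.1 → y ∈ P.1) →
      (c.proj x) ≤ c.proj y := by
    intro x y hxy
    by_contra hn
    -- The complement of a prime ideal of the quotient, pulled back along the projection, is a
    -- saturated prime filter; this one contains `x` but not `y`.
    obtain ⟨J, hJ, hyJ, hxJ⟩ := DistribLattice.prime_ideal_of_disjoint_filter_ideal
      (F := PFilter.principal (c.proj x))
      (I := Ideal.principal (c.proj y))
      (Set.disjoint_left.2 fun z hz hz' => hn (le_trans hz hz'))
    have mono : ∀ {u v : L}, u ≤ v → c.proj u ≤ c.proj v :=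
      fun {u v} huv => inf_eq_left.1 (congrArg (c.proj) (inf_eq_left.2 huv))
    have hy : c.proj y ∈ J := hyJ (Ideal.mem_principal.2 le_rfl)
    have hx : c.proj x ∉ J :=
      Set.disjoint_left.1 hxJ (PFilter.mem_principal.2 le_rfl)
    obtain ⟨P, hP⟩ := PrimeFilter.exists_coe_eq {z : L | c.proj z ∉ J}
      (fun ht => hx (J.lower (mono le_top) ht))
      (fun hb => hb (J.lower (mono bot_le) hy))
      (fun u v huv hu hv => hu (J.lower (mono huv) hv))
      (fun u v hu hv huv => (hJ.mem_or_mem (x := c.proj u)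
        (y := c.proj v) huv).elim hu hv)
      (fun u v huv => by
        by_contra! hn
        exact huv (Ideal.sup_mem (not_not.1 hn.1) (not_not.1 hn.2)))
    have hsat : c.IsSaturated P := fun u v huv hu => (hP v).2 fun hv =>
      (hP u).1 hu (by rwa [show c.proj u = _ from Quotient.sound huv])
    exact (hP y).1 (hxy P hsat ((hP x).2 hx)) hy
  have hab : c.proj a = c.proj b := le_antisymm (key a b fun P hP => (h P hP).1)
    (key b a fun P hP => (h P hP).2)
  exact Quotient.exact hab

end LatticeCon

/-! ## Tense congruences and tense filters -/

namespace TenseAlgebra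

variable {B : Type*} [TenseAlgebra B]

theorem G_top : G (⊤ : B) = ⊤ := gc_P_G.u_top

theorem H_top : H (⊤ : B) = ⊤ := gc_F_H.u_top

/-- As an upper adjoint, `G` preserves meets and order, so modus ponens passes through it. -/
theorem G_himp_le (x y : B) : G (x ⇨ y) ≤ G x ⇨ G y := by
  rw [le_himp_iff, ← gc_P_G.u_inf]
  exact gc_P_G.monotone_u himp_inf_le

theorem H_himp_le (x y : B) : H (x ⇨ y) ≤ H x ⇨ H y := by
  rw [le_himp_iff, ← gc_F_H.u_inf]
  exact gc_F_H.monotone_u himp_inf_le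

end TenseAlgebra

namespace TenseCon

variable {B : Type*} [TenseAlgebra B]

theorem himp (c : TenseCon B) {w x y z : B} (h : c.r w x) (h' : c.r y z) :
    c.r (w ⇨ y) (x ⇨ z) := by
  rw [himp_eq, himp_eq]
  exact c.sup h' (c.compl h)

/-- If both implications are congruent to `⊤`, meeting them with their premises makes `x` and `y`
each congruent to `x ⊓ y`. -/
theorem r_iff_himp (c : TenseCon B) {x y : B} :
    c.r x y ↔ c.r (x ⇨ y) ⊤ ∧ c.r (y ⇨ x) ⊤ := by
  constructor
  · intro h
    exact ⟨by simpa using c.himp h (c.refl y), by simpa using c.himp (c.refl y) h⟩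
  · rintro ⟨h1, h2⟩
    have h1' := c.inf (c.refl x) h1
    have h2' := c.inf (c.refl y) h2
    rw [inf_himp, inf_top_eq] at h1' h2'
    rw [inf_comm] at h2'
    exact c.trans (c.symm h1') h2'

/-- The class of `⊤` of a tense congruence, as a tense filter. -/
def toTenseFilter (c : TenseCon B) : TenseFilter B where
  toPFilter := IsPFilter.toPFilter (F := {x : B | c.r x ⊤}) <| IsPFilter.of_def
    ⟨⊤, c.refl ⊤⟩
    (fun x hx y hy => ⟨x ⊓ y, by simpa using c.inf hx hy, inf_le_left, inf_le_right⟩)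
    (fun {x y} hxy hx => by
      have := c.sup hx (c.refl y)
      rwa [sup_eq_right.2 hxy, top_sup_eq] at this)
  G_mem h := by
    have := c.G h
    rwa [TenseAlgebra.G_top] at this
  H_mem h := by
    have := c.H h
    rwa [TenseAlgebra.H_top] at this

end TenseCon

namespace TenseFilter

variable {B : Type*} [TenseAlgebra B]

/-- The tense congruence of a tense filter. -/
def toTenseCon (F : TenseFilter B) : TenseCon B where
  r x y := x ⇨ y ∈ F.toPFilter ∧ y ⇨ x ∈ F.toPFilter
  iseqv :=
    { refl := fun x => by simp
      symm := fun h => h.symm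
      trans := fun {x y z} h h' =>
        ⟨PFilter.mem_of_le (himp_triangle x y z) (PFilter.inf_mem h.1 h'.1),
          PFilter.mem_of_le (himp_triangle z y x) (PFilter.inf_mem h'.2 h.2)⟩ }
  inf {w x y z} h h' := by
    have key : ∀ w x y z : B, (w ⇨ x) ⊓ (y ⇨ z) ≤ (w ⊓ y) ⇨ (x ⊓ z) := fun w x y z => by
      rw [himp_inf_distrib]
      exact inf_le_inf (himp_le_himp_right inf_le_left) (himp_le_himp_right inf_le_right)
    exact ⟨PFilter.mem_of_le (key _ _ _ _) (PFilter.inf_mem h.1 h'.1),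
      PFilter.mem_of_le (key _ _ _ _) (PFilter.inf_mem h.2 h'.2)⟩
  sup {w x y z} h h' := by
    have key : ∀ w x y z : B, (w ⇨ x) ⊓ (y ⇨ z) ≤ (w ⊔ y) ⇨ (x ⊔ z) := fun w x y z => by
      rw [sup_himp_distrib]
      exact inf_le_inf (himp_le_himp_left le_sup_left) (himp_le_himp_left le_sup_right)
    exact ⟨PFilter.mem_of_le (key _ _ _ _) (PFilter.inf_mem h.1 h'.1),
      PFilter.mem_of_le (key _ _ _ _) (PFilter.inf_mem h.2 h'.2)⟩
  compl {x y} h := by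
    rwa [compl_himp_compl, compl_himp_compl, and_comm]
  G {x y} h :=
    ⟨PFilter.mem_of_le (TenseAlgebra.G_himp_le x y) (F.G_mem h.1),
      PFilter.mem_of_le (TenseAlgebra.G_himp_le y x) (F.G_mem h.2)⟩
  H {x y} h :=
    ⟨PFilter.mem_of_le (TenseAlgebra.H_himp_le x y) (F.H_mem h.1),
      PFilter.mem_of_le (TenseAlgebra.H_himp_le y x) (F.H_mem h.2)⟩

theorem toTenseCon_r {F : TenseFilter B} {x y : B} :
    F.toTenseCon.r x y ↔ x ⇨ y ∈ F.toPFilter ∧ y ⇨ x ∈ F.toPFilter := Iff.rfl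

end TenseFilter

/-- Congruences of a tense algebra correspond to its tense filters. -/
def TenseCon.orderIsoTenseFilter (B : Type*) [TenseAlgebra B] : TenseCon B ≃o TenseFilter B :=
  Equiv.toOrderIso
    { toFun := TenseCon.toTenseFilter
      invFun := TenseFilter.toTenseCon
      left_inv := fun c => TenseCon.r_injective (by
        ext x y
        exact c.r_iff_himp.symm)
      right_inv := fun F => TenseFilter.toPFilter_injective (by
        refine PFilter.ext _ _ (Set.ext fun x => ?_)
        change F.toTenseCon.r x ⊤ ↔ x ∈ F.toPFilter
        simp [TenseFilter.toTenseCon_r]) }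
    (fun _ _ h _ hx => h _ _ hx)
    (fun _ _ h _ _ hxy => ⟨h hxy.1, h hxy.2⟩)

/-! ## Congruences of a WHB-algebra and of its free tense extension -/

section FreeTense

variable {A : Type*} [WHBAlgebra A]

open WeakHeytingAlgebra WeakDifferenceAlgebra

/-! ### The Stone embedding into the free tense extension -/

namespace FreeTenseExtension

/-- The embedding of a WHB-algebra into its free tense extension. -/
def embed (a : A) : FreeTenseExtension A := ⟨stoneMap a, stoneMap_mem a⟩

theorem embed_inf (a b : A) : embed (a ⊓ b) = embed a ⊓ embed b :=
  Subtype.ext (Set.ext fun _ => PFilter.inf_mem_iff)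

theorem embed_sup (a b : A) : embed (a ⊔ b) = embed a ⊔ embed b :=
  Subtype.ext (Set.ext fun P => P.sup_mem_iff)

theorem mem_himp {U V : FreeTenseExtension A} {P : PrimeFilter A} :
    P ∈ (U ⇨ V).1 ↔ (P ∈ U.1 → P ∈ V.1) := by
  rw [himp_eq]
  change P ∈ V.1 ∨ P ∉ U.1 ↔ _
  tauto

/-- Restricting the `R`-successors to `σ(a)` amounts to weakening the target to `σ(a) ⇨ σ(b)`. -/
theorem embed_wimp (a b : A) : embed (wimp a b) = TenseAlgebra.G (embed a ⇨ embed b) := by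
  refine Subtype.ext ((stoneMap_wimp a b).trans (Set.ext fun P => ?_))
  change _ ↔ P ∈ tenseG (embed a ⇨ embed b).1
  rw [mem_tenseG]
  exact ⟨fun h Q hQ => mem_himp.2 fun ha => h ⟨hQ, ha⟩, fun h Q hQ => mem_himp.1 (h Q hQ.1) hQ.2⟩

theorem embed_wdiff (a b : A) :
    embed (wdiff a b) = (TenseAlgebra.H (embed a ⇨ embed b))ᶜ := by
  refine Subtype.ext ((stoneMap_wdiff a b).trans (Set.ext fun P => ?_))
  change _ ↔ P ∉ tenseH (embed a ⇨ embed b).1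
  rw [mem_tenseH]
  constructor
  · rintro ⟨Q, hQ, ha, hb⟩ h
    exact hb (mem_himp.1 (h Q hQ) ha)
  · intro h
    by_contra hn
    exact h fun Q hQ => mem_himp.2 fun ha => by_contra fun hb => hn ⟨Q, hQ, ha, hb⟩

/-- Every element of the free tense extension is a finite meet of implications between
elements of the WHB-algebra. -/
theorem exists_eq_inf_himp (U : FreeTenseExtension A) :
    ∃ t : Finset (A × A), U = t.inf fun p => embed p.1 ⇨ embed p.2 := by
  classical
  -- The normal form is applied to the complement: each `σ(a) \ σ(b)` is the complement of `σ(a) ⇨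
  -- σ(b)`, so De Morgan turns the union into the required meet.
  obtain ⟨t, ht⟩ := mem_freeBooleanExtension.1 (BooleanSubalgebra.compl_mem U.2)
  refine ⟨t, ?_⟩
  have key : Uᶜ = t.sup fun p => (embed p.1 ⇨ embed p.2)ᶜ := by
    refine Subtype.ext (ht.trans ?_)
    clear ht
    induction t using Finset.induction_on with
    | empty => simp
    | insert p t _ ih =>
      rw [Finset.set_biUnion_insert, Finset.sup_insert, ih]
      refine congrArg₂ (· ∪ ·) (Set.ext fun P => ?_) rfl
      change _ ↔ P ∉ (embed p.1 ⇨ embed p.2).1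
      rw [mem_himp, Classical.not_imp]
      rfl
  rw [← compl_compl U, key, Finset.compl_sup]
  simp only [compl_compl]

end FreeTenseExtension

open FreeTenseExtension

/-! ### Extending congruences to the free tense extension -/

namespace WHBCon

theorem r_bot_of_r (c : WHBCon A) {a b : A} (h : c.r a b) :
    c.r (WeakDifferenceAlgebra.wdiff a b) ⊥ := by
  simpa [wdiff_self] using c.wdiff h (c.refl b)

theorem r_top_of_r (c : WHBCon A) {a b : A} (h : c.r a b) :
    c.r (WeakHeytingAlgebra.wimp a b) ⊤ := by
  simpa [wimp_self] using c.wimp h (c.refl b)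

/-- If `a` and `b` are congruent, then `a → b` is congruent to `⊤` and so lies in the saturated `P`;
the definition of `R` then carries `a ∈ Q` to `b ∈ Q`. -/
theorem isSaturated_of_relR (c : WHBCon A) {P Q : PrimeFilter A} (hP : c.IsSaturated P)
    (h : relR P Q) : c.IsSaturated Q := fun a b hab ha =>
  h a b (hP _ _ (c.symm (c.r_top_of_r hab)) PFilter.top_mem) ha

/-- Dually, `a ← b` is congruent to `⊥`, so it cannot lie in the saturated proper filter `P`. -/
theorem isSaturated_of_relS (c : WHBCon A) {P Q : PrimeFilter A} (hP : c.IsSaturated P)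
    (h : relS P Q) : c.IsSaturated Q := fun a b hab ha => by
  by_contra hb
  exact P.bot_notMem (hP _ _ (c.r_bot_of_r hab) (h a b ha hb))

/-- The extension of a congruence to the free tense extension: two sets are congruent if they
contain the same saturated prime filters. -/
def toTenseCon (c : WHBCon A) : TenseCon (FreeTenseExtension A) where
  r U V := ∀ P, c.IsSaturated P → (P ∈ U.1 ↔ P ∈ V.1)
  iseqv := ⟨fun _ _ _ => Iff.rfl, fun h P hP => (h P hP).symm,
    fun h h' P hP => (h P hP).trans (h' P hP)⟩
  inf h h' P hP := and_congr (h P hP) (h' P hP)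
  sup h h' P hP := or_congr (h P hP) (h' P hP)
  compl h P hP := not_congr (h P hP)
  G {U V} h P hP := by
    change P ∈ tenseG U.1 ↔ P ∈ tenseG V.1
    rw [mem_tenseG, mem_tenseG]
    exact forall₂_congr fun Q hQ => h Q (c.isSaturated_of_relR hP hQ)
  H {U V} h P hP := by
    change P ∈ tenseH U.1 ↔ P ∈ tenseH V.1
    rw [mem_tenseH, mem_tenseH]
    exact forall₂_congr fun Q hQ => h Q (c.isSaturated_of_relS hP hQ)

theorem toTenseCon_embed {c : WHBCon A} {a b : A} :
    c.toTenseCon.r (embed a) (embed b) ↔ c.r a b :=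
  ⟨fun h => c.r_of_forall_isSaturated h,
    fun h _ hP => ⟨hP a b h, hP b a (c.symm h)⟩⟩

end WHBCon

/-! ### Restricting congruences to the WHB-algebra -/

namespace TenseCon

/-- The restriction of a congruence of the free tense extension to the WHB-algebra. -/
def toWHBCon (c : TenseCon (FreeTenseExtension A)) : WHBCon A where
  r a b := c.r (embed a) (embed b)
  iseqv := ⟨fun a => c.refl (embed a), c.symm, c.trans⟩
  inf h h' := by
    rw [embed_inf, embed_inf]
    exact c.inf h h'
  sup h h' := by
    rw [embed_sup, embed_sup]
    exact c.sup h h'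
  wimp h h' := by
    rw [embed_wimp, embed_wimp]
    exact c.G (c.himp h h')
  wdiff h h' := by
    rw [embed_wdiff, embed_wdiff]
    exact c.compl (c.H (c.himp h h'))

/-- Trades an implication for a lattice condition, which `embed` can reflect: `x ⇨ (x ⊓ y)` equals
`x ⇨ y`, and the converse implication is `⊤`. -/
theorem himp_r_top_iff {B : Type*} [TenseAlgebra B] (c : TenseCon B) {x y : B} :
    c.r (x ⇨ y) ⊤ ↔ c.r (x ⊓ y) x := by
  rw [c.r_iff_himp (x := x ⊓ y)]
  rw [himp_eq_top_iff.2 (inf_le_left : x ⊓ y ≤ x), himp_inf_distrib, himp_self, top_inf_eq]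
  exact (and_iff_right (c.refl ⊤)).symm

theorem inf_r_top_iff {B ι : Type*} [TenseAlgebra B] (c : TenseCon B) (t : Finset ι)
    (f : ι → B) : c.r (t.inf f) ⊤ ↔ ∀ i ∈ t, c.r (f i) ⊤ := by
  classical
  induction t using Finset.induction_on with
  | empty => simp
  | insert i t _ ih =>
    rw [Finset.inf_insert, Finset.forall_mem_insert, ← ih]
    exact PFilter.inf_mem_iff (F := c.toTenseFilter.toPFilter)

/-- A congruence of the free tense extension is determined by its restriction. -/
theorem toWHBCon_injective :
    Function.Injective (toWHBCon : TenseCon (FreeTenseExtension A) → WHBCon A) := by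
  intro c d h
  -- It suffices to compare the classes of `⊤`.
  refine (TenseCon.orderIsoTenseFilter (FreeTenseExtension A)).injective
    (TenseFilter.toPFilter_injective (PFilter.ext _ _ (Set.ext fun U => ?_)))
  change c.r U ⊤ ↔ d.r U ⊤
  obtain ⟨t, rfl⟩ := exists_eq_inf_himp U
  have hr : ∀ a b, c.r (embed a) (embed b) ↔ d.r (embed a) (embed b) := fun a b =>
    iff_of_eq (congrFun (congrFun (congrArg (fun e : WHBCon A => e.r) h) a) b)
  simp only [inf_r_top_iff, himp_r_top_iff, ← embed_inf, hr]

end TenseCon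

variable (A) in
/-- The congruences of a WHB-algebra correspond to those of its free tense extension. -/
def WHBCon.orderIsoTenseCon : WHBCon A ≃o TenseCon (FreeTenseExtension A) :=
  have toWHBCon_toTenseCon : ∀ c : WHBCon A, c.toTenseCon.toWHBCon = c := fun _ =>
    WHBCon.r_injective (funext₂ fun _ _ => propext WHBCon.toTenseCon_embed)
  Equiv.toOrderIso
    { toFun := WHBCon.toTenseCon
      invFun := TenseCon.toWHBCon
      left_inv := toWHBCon_toTenseCon
      -- Extending a restriction and restricting again gives the same restriction, so injectivity
      -- recovers the original congruence.
      right_inv := fun _ => TenseCon.toWHBCon_injective (toWHBCon_toTenseCon _) }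
    -- A larger congruence has fewer saturated prime filters, hence identifies more sets.
    (fun _ _ h _ _ hUV P hP => hUV P fun a b hab => hP a b (h a b hab))
    (fun _ _ h _ _ hab => h _ _ hab)

end FreeTense

/-- For every WHB-algebra `A`, the congruence lattice of `A` is isomorphic to the congruence
lattice of its free tense extension `T(A)`, and also to the lattice of tense filters of `T(A)`. -/
theorem mainTheorem5 {A : Type*} [WHBAlgebra A] :
    Nonempty (WHBCon A ≃o TenseCon (FreeTenseExtension A)) ∧
      Nonempty (WHBCon A ≃o TenseFilter (FreeTenseExtension A)) :=
  ⟨⟨WHBCon.orderIsoTenseCon A⟩,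
    ⟨(WHBCon.orderIsoTenseCon A).trans (TenseCon.orderIsoTenseFilter _)⟩⟩
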